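/- Let $D\ge 3$ and let $(M,g)$ be a spacetime: a connected smooth manifold $M$ of dimension $D+1$ with a $C^1$ Lorentzian metric $g$ of signature $(-,+,\dots,+)$. Suppose that an open subset of $M$ carries smooth coordinates $(t,x)$ which map it diffeomorphically onto $\mathbb R\times(\mathbb R^D\setminus B)$, where $B$ is the closed ball of radius $R>0$ about the origin; write $r=|x|$. Suppose that in these coordinates $g$ is asymptotically Schwarzschildean with ADM mass $m_{ADM}<0$, that is, with $m$ defined by $m_{ADM}=\frac{(D-1)\,\mathrm{Area}(S^{D-1})}{8\pi}\,m$ (so that $R^{D-2}>m/2$ automatically) and $$g_m=-\Bigl(1-\frac{2m}{r^{D-2}}\Bigr)dt^2+\Bigl(1-\frac{2m}{r^{D-2}}\Bigr)^{-1}dr^2+r^2\,d\omega_{D-1}^2,$$ the components of $g-g_m$ in the coordinates $(t,x)$ are $o(|m|\,|x|^{-(D-2)})$ as $|x|\to\infty$, uniformly in $t$ and in $x/|x|$. Put $u=t-r$, $v=t+r$, and adjoin to the coordinate region the null infinities $\mathcal I^\pm$ of the standard conformal compactification of Minkowski spacetime, $(t,x)\mapsto(T,\chi,\omega)=(\arctan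 v+\arctan u,\ \arctan v-\arctan u,\ x/r)\in\mathbb R\times S^D$. Points of $\mathcal I^+$ (where $v=\infty$) are labelled by $(u,\omega)\in\mathbb R\times S^{D-1}$, and points of $\mathcal I^-$ (where $u=-\infty$) by $(v,\omega)\in\mathbb R\times S^{D-1}$. Let $n\in\mathbb R^D$ be a unit vector, so that $k=(1,n)$ is a radial outgoing future-pointing Minkowski-null direction (for example $k=(1,0,\dots,0,1)$), and let $\Lambda^+=\{\omega=n\}\subset\mathcal I^+$ and $\Lambda^-=\{\omega=-n\}\subset\mathcal I^-$ be the corresponding generators. Then there is a smooth curve $\gamma:\mathbb R\to M$ which is $g$-timelike everywhere and endless (it has neither a past nor a future endpoint in $M$), which has its past endpoint on $\Lambda^-$, at some advanced time $v_\infty\in\mathbb R$, and its future endpoint on $\Lambda^+$, at some retarded time $u_\infty\in\mathbb R$, and whose time of flight is strictly negative: $$u_\infty-v_\infty<0 .$$ -/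

import Mathlib

open Set Filter Topology MeasureTheory
open scoped Manifold ContDiff

noncomputable section

/-- Euclidean space `ℝ^D`, with its standard inner product and norm. -/
abbrev Space (D : ℕ) : Type := EuclideanSpace ℝ (Fin D)

/-- The model vector space of a `(D + 1)`-dimensional manifold. -/
abbrev ModelE (D : ℕ) : Type := EuclideanSpace ℝ (Fin (D + 1))

/-- A `C¹` Lorentzian metric of signature `(D, 1)` (mostly plus) on a `(D + 1)`-dimensional
manifold `M`: a `C¹` section of symmetric bilinear forms on the tangent spaces, such that every
tangent space contains a timelike vector whose orthogonal complement is positive definite. -/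
structure LorentzianMetric (D : ℕ) (M : Type*) [TopologicalSpace M]
    [ChartedSpace (ModelE D) M] [IsManifold 𝓘(ℝ, ModelE D) ∞ M] where
  /-- The bilinear form on the tangent space at `p`. -/
  inner (p : M) : TangentSpace 𝓘(ℝ, ModelE D) p →L[ℝ] TangentSpace 𝓘(ℝ, ModelE D) p →L[ℝ] ℝ
  symm (p : M) (a b : TangentSpace 𝓘(ℝ, ModelE D) p) : inner p a b = inner p b a
  signature (p : M) : ∃ T : TangentSpace 𝓘(ℝ, ModelE D) p, inner p T T < 0 ∧
    ∀ a : TangentSpace 𝓘(ℝ, ModelE D) p, inner p T a = 0 → a ≠ 0 → 0 < inner p a a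
  contMDiff : ContMDiff 𝓘(ℝ, ModelE D)
    (𝓘(ℝ, ModelE D).prod 𝓘(ℝ, ModelE D →L[ℝ] ModelE D →L[ℝ] ℝ)) 1
    (fun p : M ↦ Bundle.TotalSpace.mk' (ModelE D →L[ℝ] ModelE D →L[ℝ] ℝ)
      (E := fun p : M ↦
        (TangentSpace 𝓘(ℝ, ModelE D) p →L[ℝ] TangentSpace 𝓘(ℝ, ModelE D) p →L[ℝ] ℝ))
      p (inner p))

/-- Coordinates `(t, x)` near infinity: a smooth diffeomorphism from an open subset of `M` onto
`ℝ × (ℝ^D ∖ B)`, where `B` is the closed ball of radius `R > 0` about the origin. -/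
structure ExteriorCoordinates (D : ℕ) (M : Type*) [TopologicalSpace M]
    [ChartedSpace (ModelE D) M] where
  /-- The radius of the excised ball. -/
  R : ℝ
  R_pos : 0 < R
  /-- The coordinate map `p ↦ (t, x)`. -/
  toCoord : OpenPartialHomeomorph M (ℝ × Space D)
  target_eq : toCoord.target = {p : ℝ × Space D | R < ‖p.2‖}
  contMDiffOn_toCoord :
    ContMDiffOn 𝓘(ℝ, ModelE D) 𝓘(ℝ, ℝ × Space D) ∞ toCoord toCoord.source
  contMDiffOn_symm :
    ContMDiffOn 𝓘(ℝ, ℝ × Space D) 𝓘(ℝ, ModelE D) ∞ toCoord.symm toCoord.target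

/-- The Schwarzschild metric of mass parameter `m`,
`-(1 - 2m/r^(D-2)) dt² + (1 - 2m/r^(D-2))⁻¹ dr² + r² dω²`,
at `p = (t, x)`, evaluated on the vectors `a`, `b` in the Cartesian coordinates `(t, x = r ω)`.
Here `r = |x|`, `dr(a) = ⟨x, a⟩ / r` and `r² dω² = |dx|² - dr²`. -/
def schwarzschildMetric (D : ℕ) (m : ℝ) (p a b : ℝ × Space D) : ℝ :=
  -(1 - 2 * m / ‖p.2‖ ^ (D - 2)) * (a.1 * b.1)
    + (1 - 2 * m / ‖p.2‖ ^ (D - 2))⁻¹ *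
        ((inner ℝ p.2 a.2 / ‖p.2‖) * (inner ℝ p.2 b.2 / ‖p.2‖))
    + (inner ℝ a.2 b.2 - (inner ℝ p.2 a.2 / ‖p.2‖) * (inner ℝ p.2 b.2 / ‖p.2‖))

/-- The area of the unit sphere `S^(D-1)` in `ℝ^D`. -/
def sphereArea (D : ℕ) : ℝ := (volume : Measure (Space D)).toSphere.real univ

/-- The ADM mass of the Schwarzschild metric with mass parameter `m` (units `c = G = 1`). -/
def admMass (D : ℕ) (m : ℝ) : ℝ := ((D : ℝ) - 1) * sphereArea D / (8 * Real.pi) * m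

section Spacetime

variable {D : ℕ} {M : Type*} [TopologicalSpace M] [ChartedSpace (ModelE D) M]

/-- The metric at the point with coordinates `p`, evaluated on the vectors whose components with
respect to the coordinates `(t, x)` are `a` and `b`. -/
def coordMetric [IsManifold 𝓘(ℝ, ModelE D) ∞ M] (g : LorentzianMetric D M)
    (c : ExteriorCoordinates D M) (p a b : ℝ × Space D) : ℝ :=
  g.inner (c.toCoord.symm p)
    (mfderiv 𝓘(ℝ, ℝ × Space D) 𝓘(ℝ, ModelE D) c.toCoord.symm p a)
    (mfderiv 𝓘(ℝ, ℝ × Space D) 𝓘(ℝ, ModelE D) c.toCoord.symm p b)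

/-- In the coordinates `c`, the metric `g` is asymptotically Schwarzschildean with nonzero ADM mass
`mADM`: all the Cartesian components of `g - g_m` (equivalently, its values on all pairs of
constant vectors) are `o(|m| |x|^(-(D-2)))` as `|x| → ∞`, uniformly in `t` and in the direction
of `x`. -/
def IsAsymptoticallySchwarzschildean [IsManifold 𝓘(ℝ, ModelE D) ∞ M] (g : LorentzianMetric D M)
    (c : ExteriorCoordinates D M) (mADM : ℝ) : Prop :=
  mADM ≠ 0 ∧ ∃ m : ℝ, mADM = admMass D m ∧ m / 2 < c.R ^ (D - 2) ∧
    ∀ a b : ℝ × Space D,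
      (fun p : ℝ × Space D ↦ coordMetric g c p a b - schwarzschildMetric D m p a b)
        =o[comap (fun p : ℝ × Space D ↦ ‖p.2‖) atTop]
      (fun p : ℝ × Space D ↦ |m| / ‖p.2‖ ^ (D - 2))

/-- `γ` is a smooth curve in `M` which is timelike with respect to `g` everywhere. -/
def IsTimelikeCurve [IsManifold 𝓘(ℝ, ModelE D) ∞ M] (g : LorentzianMetric D M)
    (γ : ℝ → M) : Prop :=
  ContMDiff 𝓘(ℝ, ℝ) 𝓘(ℝ, ModelE D) ∞ γ ∧
    ∀ s : ℝ, g.inner (γ s) (mfderiv 𝓘(ℝ, ℝ) 𝓘(ℝ, ModelE D) γ s (1 : ℝ))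
      (mfderiv 𝓘(ℝ, ℝ) 𝓘(ℝ, ModelE D) γ s (1 : ℝ)) < 0

/-- `γ` is endless: it has neither a past nor a future endpoint in the spacetime `M`. -/
def IsEndless (γ : ℝ → M) : Prop :=
  ∀ p : M, ¬ Tendsto γ atTop (𝓝 p) ∧ ¬ Tendsto γ atBot (𝓝 p)

end Spacetime

/-- The space `ℝ × ℝ^D × ℝ`, which contains the Einstein static universe `ℝ × S^D`. -/
abbrev EinsteinAmbient (D : ℕ) : Type := ℝ × (Space D × ℝ)

/-- The point of the Einstein static universe `ℝ × S^D` with coordinates `(T, χ, w)`. -/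
def einsteinPoint {D : ℕ} (T χ : ℝ) (w : Space D) : EinsteinAmbient D :=
  (T, (Real.sin χ • w, Real.cos χ))

/-- The standard conformal compactification of Minkowski spacetime: with `u = t - r`, `v = t + r`,
the point `(t, x)` goes to `T = arctan v + arctan u`, `χ = arctan v - arctan u`, `w = x / r`. -/
def compactify {D : ℕ} (p : ℝ × Space D) : EinsteinAmbient D :=
  einsteinPoint (Real.arctan (p.1 + ‖p.2‖) + Real.arctan (p.1 - ‖p.2‖))
    (Real.arctan (p.1 + ‖p.2‖) - Real.arctan (p.1 - ‖p.2‖)) (‖p.2‖⁻¹ • p.2)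

/-- The point of future null infinity (`v = ∞`) with retarded time `u` and direction `w`. -/
def scriPlusPoint {D : ℕ} (u : ℝ) (w : Space D) : EinsteinAmbient D :=
  einsteinPoint (Real.pi / 2 + Real.arctan u) (Real.pi / 2 - Real.arctan u) w

/-- The point of past null infinity (`u = -∞`) with advanced time `v` and direction `w`. -/
def scriMinusPoint {D : ℕ} (v : ℝ) (w : Space D) : EinsteinAmbient D :=
  einsteinPoint (Real.arctan v - Real.pi / 2) (Real.arctan v + Real.pi / 2) w

section TimeOfFlight

variable {D : ℕ} {M : Type*} [TopologicalSpace M] [ChartedSpace (ModelE D) M]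

/-- Let `n` be the unit vector for which `k = (1, n)`. The generator `Λ⁺` of future null infinity
belonging to `k` consists of the points with direction `n`. The curve `γ` has its future endpoint
on `Λ⁺`, at the retarded time `u`. -/
def HasFutureEndpointAt (c : ExteriorCoordinates D M) (n : Space D) (γ : ℝ → M) (u : ℝ) : Prop :=
  (∀ᶠ s in atTop, γ s ∈ c.toCoord.source) ∧
    Tendsto (fun s ↦ compactify (c.toCoord (γ s))) atTop (𝓝 (scriPlusPoint u n))

/-- The generator `Λ⁻` of past null infinity belonging to `k = (1, n)` (reached along the
past-directed direction `-k`) consists of the points with direction `-n`. The curve `γ` has its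
past endpoint on `Λ⁻`, at the advanced time `v`. -/
def HasPastEndpointAt (c : ExteriorCoordinates D M) (n : Space D) (γ : ℝ → M) (v : ℝ) : Prop :=
  (∀ᶠ s in atBot, γ s ∈ c.toCoord.source) ∧
    Tendsto (fun s ↦ compactify (c.toCoord (γ s))) atBot (𝓝 (scriMinusPoint v (-n)))

end TimeOfFlight

end

/-! For negative mass the Minkowski light cone lies strictly inside the cone of `g` far out: `g(k,k)
≤ -m₀/r^(D-2)` for `k = (1, n)`. So the straight line `s ↦ (s, b e + s n)`, with `e ⟂ n` a unit
vector and `b > R` large, is `g`-timelike and has time of flight zero. There is room to arrive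
earlier: subtract `δ * timeGain s` from the time coordinate. The velocity becomes `k + φ ∂_t` with
`φ = -δ * timeGain'`, and `g` on it is `g(k,k) + 2 φ g(k,∂_t) + φ² g(∂_t,∂_t)`. For `|s| ≤ 2`,
`g(k,k)` is bounded away from zero and a small `δ` is harmless. For `|s| ≥ 2`, `φ` is positive of
order `δ/s²`, and since `g(k,∂_t) ≤ -1/2` the middle term also has the timelike sign. As `timeGain`
tends to `±π/2`, the time of flight is `-δ π`. Endlessness is not automatic, since `M` is an
arbitrary extension of the coordinate region. It follows from infinite proper length: `φ ~ 1/s²`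
gives length at least `κ/|s|` per unit parameter (`exists_gainCurve_coordMetric_lt`), whereas near a
point of `M` proper length is controlled by the variation of one linear chart coordinate
(`exists_eventually_neg_inner_le`), which would then diverge. -/

noncomputable section

/-! ### Proper length and endpoints in the spacetime -/

/-- A Lorentzian form becomes positive definite after adding a large multiple of the square of
the functional dual to a timelike vector. -/
theorem exists_mul_norm_sq_le_add_mul_sq {V : Type*} [NormedAddCommGroup V] [NormedSpace ℝ V]
    [FiniteDimensional ℝ V] (B : V →L[ℝ] V →L[ℝ] ℝ) (symm : ∀ a b, B a b = B b a) {T : V}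
    (hT : B T T < 0) (hpos : ∀ a, B T a = 0 → a ≠ 0 → 0 < B a a) :
    ∃ C > 0, ∃ c > 0, ∀ a, c * ‖a‖ ^ 2 ≤ B a a + C * (B T a) ^ 2 := by
  set C : ℝ := 1 - (B T T)⁻¹ with hC
  have hCpos : 0 < C := by
    have := inv_lt_zero.2 hT
    linarith
  have key : ∀ a, a ≠ 0 → 0 < B a a + C * (B T a) ^ 2 := by
    intro a ha
    -- `a - l • T` is the component of `a` orthogonal to `T`. The remaining part contributes `(B T
    -- a)² / B T T` to `B a a`; the choice of `C` cancels this and leaves `(B T a)²`.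
    set l := B T a / B T T with hl
    have hlT : l * B T T = B T a := div_mul_cancel₀ _ hT.ne
    have h0 : B T (a - l • T) = 0 := by simp [hlT]
    have h1 : B (a - l • T) (a - l • T) = B a a - (B T a) ^ 2 * (B T T)⁻¹ := by
      have : B (a - l • T) (a - l • T) = B a (a - l • T) - l * B T (a - l • T) := by simp
      rw [this, h0]
      simp only [map_sub, map_smul, smul_eq_mul, symm a T]
      rw [hl]
      ring
    have h2 : B a a + C * (B T a) ^ 2 = B (a - l • T) (a - l • T) + (B T a) ^ 2 := by
      rw [h1, hC]; ring
    rw [h2]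
    by_cases h3 : a - l • T = 0
    · have h4 : B T a ≠ 0 := by
        intro h
        apply ha
        rw [sub_eq_zero.1 h3, hl, h]
        simp
      rw [h3]
      simpa using pow_pos (abs_pos.2 h4) 2
    · have := hpos _ h0 h3
      positivity
  refine ⟨C, hCpos, ?_⟩
  rcases subsingleton_or_nontrivial V with h | h
  · exact ⟨1, one_pos, fun a ↦ by simp [Subsingleton.elim a 0]⟩
  have hcont : Continuous fun a ↦ B a a + C * (B T a) ^ 2 := by fun_prop
  obtain ⟨a₀, ha₀, hmin⟩ := (isCompact_sphere (0 : V) 1).exists_isMinOn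
    (NormedSpace.sphere_nonempty.2 zero_le_one) hcont.continuousOn
  refine ⟨_, key a₀ (by rintro rfl; simp at ha₀), fun a ↦ ?_⟩
  by_cases ha : a = 0
  · simp [ha]
  have hna : ‖a‖ ≠ 0 := norm_ne_zero_iff.2 ha
  have := hmin (show ‖a‖⁻¹ • a ∈ Metric.sphere (0 : V) 1 by simp [norm_smul, hna])
  simp only [mem_ofPred_eq, map_smul, FunLike.coe_smul, Pi.smul_apply, smul_eq_mul] at this
  calc _ ≤ (‖a‖⁻¹ * (‖a‖⁻¹ * B a a) + C * (‖a‖⁻¹ * B T a) ^ 2) * ‖a‖ ^ 2 :=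
        mul_le_mul_of_nonneg_right this (by positivity)
    _ = _ := by field_simp

/-- A function whose derivative is at least `κ / s` in absolute value does not converge. -/
theorem not_tendsto_nhds_of_div_le_abs_deriv {f f' : ℝ → ℝ} {κ : ℝ} (hκ : 0 < κ)
    (h : ∀ᶠ s in atTop, HasDerivAt f (f' s) s ∧ κ / s ≤ |f' s|) (l : ℝ) :
    ¬ Tendsto f atTop (𝓝 l) := by
  have main : ∀ {F F' : ℝ → ℝ} {s₀ : ℝ}, 0 < s₀ → (∀ s ∈ Ici s₀, HasDerivAt F (F' s) s) →
      (∀ s ∈ Ici s₀, κ / s ≤ F' s) → Tendsto F atTop atTop := by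
    intro F F' s₀ hs₀ hF hF'
    -- Comparison with `κ * log s`, whose derivative is `κ / s`.
    have hd : ∀ s ∈ Ici s₀, HasDerivAt (fun s ↦ F s - κ * Real.log s) (F' s - κ * s⁻¹) s :=
      fun s hs ↦ (hF s hs).sub ((Real.hasDerivAt_log (hs₀.trans_le hs).ne').const_mul κ)
    have hmono : MonotoneOn (fun s ↦ F s - κ * Real.log s) (Ici s₀) := by
      refine monotoneOn_of_deriv_nonneg (convex_Ici s₀)
        (fun s hs ↦ (hd s hs).continuousAt.continuousWithinAt)
        (fun s hs ↦ (hd s (interior_subset hs)).differentiableAt.differentiableWithinAt) ?_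
      intro s hs
      rw [(hd s (interior_subset hs)).deriv, ← div_eq_mul_inv]
      exact sub_nonneg.2 (hF' s (interior_subset hs))
    have hlog : Tendsto (fun s ↦ (F s₀ - κ * Real.log s₀) + κ * Real.log s) atTop atTop :=
      tendsto_atTop_add_const_left _ _ (Real.tendsto_log_atTop.const_mul_atTop hκ)
    refine tendsto_atTop_mono' _ ?_ hlog
    filter_upwards [eventually_ge_atTop s₀] with s hs
    have := hmono self_mem_Ici hs hs
    simp only at this
    linarith
  obtain ⟨s₀, hs₀⟩ := eventually_atTop.1 (h.and (eventually_gt_atTop 0))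
  have hpos : 0 < s₀ := (hs₀ s₀ le_rfl).2
  have hquot : ∀ s ∈ Ici s₀, 0 < κ / s := fun s hs ↦ div_pos hκ (hs₀ s hs).2
  -- By Darboux, a derivative that never vanishes has constant sign.
  rcases hasDerivWithinAt_forall_lt_or_forall_gt_of_forall_ne (m := 0) (convex_Ici s₀)
    (fun s hs ↦ (hs₀ s hs).1.1.hasDerivWithinAt) (fun s hs h0 ↦ by
      have h1 := (hs₀ s hs).1.2
      rw [h0, abs_zero] at h1
      exact absurd h1 (not_le.2 (hquot s hs))) with hneg | hpos'
  · intro hl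
    refine not_tendsto_nhds_of_tendsto_atTop (main (F := -f) hpos
      (fun s hs ↦ (hs₀ s hs).1.1.neg) fun s hs ↦ ?_) _ hl.neg
    simpa [abs_of_neg (hneg s hs)] using (hs₀ s hs).1.2
  · refine not_tendsto_nhds_of_tendsto_atTop (main hpos
      (fun s hs ↦ (hs₀ s hs).1.1) fun s hs ↦ ?_) _
    simpa [abs_of_pos (hpos' s hs)] using (hs₀ s hs).1.2

namespace LorentzianMetric

variable {D : ℕ} {M : Type*} [TopologicalSpace M] [ChartedSpace (ModelE D) M]
  [IsManifold 𝓘(ℝ, ModelE D) ∞ M]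

/-- Near every point, the squared proper length of a vector is bounded by the square of a fixed
linear functional in a chart. -/
theorem exists_eventually_neg_inner_le (g : LorentzianMetric D M) (p : M) :
    ∃ (τ : ModelE D →L[ℝ] ℝ) (C : ℝ), 0 < C ∧ ∀ᶠ q in 𝓝 p,
      ∀ a : TangentSpace 𝓘(ℝ, ModelE D) q, -g.inner q a a ≤
        C * (τ (mfderiv 𝓘(ℝ, ModelE D) 𝓘(ℝ, ModelE D)
          (extChartAt 𝓘(ℝ, ModelE D) p) q a)) ^ 2 := by
  let e := trivializationAt (ModelE D) (TangentSpace 𝓘(ℝ, ModelE D) : M → Type _) p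
  let G : M → ModelE D →L[ℝ] ModelE D →L[ℝ] ℝ := fun q ↦
    ContinuousLinearMap.inCoordinates (ModelE D) (TangentSpace 𝓘(ℝ, ModelE D) : M → Type _)
      (ModelE D →L[ℝ] ℝ) (fun q : M ↦ TangentSpace 𝓘(ℝ, ModelE D) q →L[ℝ] ℝ) p q p q (g.inner q)
  have hG : ContinuousAt G p := by
    have := g.contMDiff.continuous.continuousAt (x := p)
    rw [continuousAt_hom_bundle] at this
    exact this.2
  have hGapp : ∀ q ∈ e.baseSet, ∀ v w, G q v w = g.inner q (e.symmL ℝ q v) (e.symmL ℝ q w) := by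
    intro q hq v w
    simp only [G]
    rw [inCoordinates_apply_eq₂ (E₃ := fun _ ↦ ℝ) hq hq (mem_univ _), e.symmL_apply hq, e.symmL_apply hq]
    simp [e]
  have hp : p ∈ e.baseSet := FiberBundle.mem_baseSet_trivializationAt' p
  have hinv : ∀ q ∈ e.baseSet, ∀ a, e.symmL ℝ q (e.continuousLinearMapAt ℝ q a) = a :=
    fun q hq a ↦ e.symmL_continuousLinearMapAt hq a
  obtain ⟨T, hT, hpos⟩ := g.signature p
  set T' := e.continuousLinearMapAt ℝ p T with hT'
  obtain ⟨C, hC, c, hc, hbound⟩ := exists_mul_norm_sq_le_add_mul_sq (G p) (T := T')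
    (fun a b ↦ by rw [hGapp p hp, hGapp p hp, g.symm])
    (by rwa [hGapp p hp, hinv p hp])
    (fun a ha ha0 ↦ by
      rw [hGapp p hp, hinv p hp] at ha
      rw [hGapp p hp]
      refine hpos _ ha fun h ↦ ha0 ?_
      rw [← e.continuousLinearMapAt_symmL (R := ℝ) hp a, h, map_zero])
  refine ⟨G p T', C, hC, ?_⟩
  -- The bound at `p` has a margin `c * ‖v‖²`, which absorbs the change of the form from `p` to a
  -- nearby `q`; the functional `G p T'` can thus stay fixed.
  filter_upwards [(Metric.continuousAt_iff' (α := ModelE D →L[ℝ] ModelE D →L[ℝ] ℝ)).1 hG c hc,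
    e.open_baseSet.mem_nhds hp] with q hq hqe a
  have hqs : q ∈ (chartAt (ModelE D) p).source := by simpa [e] using hqe
  have hmf : mfderiv 𝓘(ℝ, ModelE D) 𝓘(ℝ, ModelE D) (extChartAt 𝓘(ℝ, ModelE D) p) q a =
      e.continuousLinearMapAt ℝ q a :=
    (DFunLike.congr_fun (TangentBundle.continuousLinearMapAt_trivializationAt hqs) a).symm
  rw [hmf]
  set v := e.continuousLinearMapAt ℝ q a with hv
  have h1 : g.inner q a a = G q v v := by rw [hGapp q hqe, hv, hinv q hqe]
  have h2 : |(G q - G p) v v| ≤ c * ‖v‖ ^ 2 := by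
    have hq' : ‖G q - G p‖ < c := (dist_eq_norm (G q) (G p)).symm.trans_lt hq
    calc |(G q - G p) v v| ≤ ‖G q - G p‖ * ‖v‖ * ‖v‖ :=
          ContinuousLinearMap.le_opNorm₂ (G q - G p) v v
      _ ≤ c * ‖v‖ * ‖v‖ := by gcongr
      _ = c * ‖v‖ ^ 2 := by ring
  have h3 := hbound v
  have h4 : (G q - G p) v v = G q v v - G p v v := by simp
  rw [h4] at h2
  rw [h1]
  have := (abs_le.1 h2).1
  linarith

/-- A curve whose proper length per unit parameter is at least `κ / s` has infinite proper length,
and thus no future endpoint. -/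
theorem not_tendsto_nhds_of_inner_le (g : LorentzianMetric D M) {γ : ℝ → M}
    (hγ : MDifferentiable 𝓘(ℝ, ℝ) 𝓘(ℝ, ModelE D) γ) {κ : ℝ} (hκ : 0 < κ)
    (h : ∀ᶠ s in atTop, g.inner (γ s) (mfderiv 𝓘(ℝ, ℝ) 𝓘(ℝ, ModelE D) γ s (1 : ℝ))
      (mfderiv 𝓘(ℝ, ℝ) 𝓘(ℝ, ModelE D) γ s (1 : ℝ)) ≤ -(κ / s) ^ 2) (p : M) :
    ¬ Tendsto γ atTop (𝓝 p) := by
  intro hp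
  obtain ⟨τ, C, hC, hτ⟩ := g.exists_eventually_neg_inner_le p
  set φ := extChartAt 𝓘(ℝ, ModelE D) p
  have hlim : Tendsto (fun s ↦ τ (φ (γ s))) atTop (𝓝 (τ (φ p))) :=
    (τ.continuous.tendsto _).comp ((continuousAt_extChartAt p).tendsto.comp hp)
  refine not_tendsto_nhds_of_div_le_abs_deriv
    (f' := fun s ↦ τ (mfderiv 𝓘(ℝ, ModelE D) 𝓘(ℝ, ModelE D) φ (γ s)
      (mfderiv 𝓘(ℝ, ℝ) 𝓘(ℝ, ModelE D) γ s (1 : ℝ)))) (κ := κ / √C) (by positivity) ?_ _ hlim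
  filter_upwards [h, hp.eventually hτ, hp (chart_source_mem_nhds (ModelE D) p),
    eventually_gt_atTop 0] with s hs hsτ hsrc hs0
  constructor
  · have h1 : HasMFDerivAt 𝓘(ℝ, ℝ) 𝓘(ℝ, ModelE D) (φ ∘ γ) s _ :=
      (mdifferentiableAt_extChartAt hsrc).hasMFDerivAt.comp s (hγ s).hasMFDerivAt
    have h2 := (τ.hasFDerivAt (x := φ (γ s))).comp s h1.hasFDerivAt
    exact h2.hasDerivAt
  · have h1 := hsτ (mfderiv 𝓘(ℝ, ℝ) 𝓘(ℝ, ModelE D) γ s (1 : ℝ))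
    refine abs_le_of_sq_le_sq' ?_ (abs_nonneg _) |>.2
    rw [sq_abs, show κ / √C / s = κ / s / √C by ring, div_pow, Real.sq_sqrt hC.le,
      div_le_iff₀' hC]
    linarith

end LorentzianMetric

/-! ### Convergence to null infinity -/

/-- Curves in the exterior region that recede to infinity with convergent retarded time and
direction have an endpoint on future null infinity. -/
theorem tendsto_compactify_scriPlusPoint {D : ℕ} {α : Type*} {l : Filter α} {t : α → ℝ}
    {x : α → Space D} {u : ℝ} {w : Space D} (hx : Tendsto (fun s ↦ ‖x s‖) l atTop)
    (hu : Tendsto (fun s ↦ t s - ‖x s‖) l (𝓝 u)) (hw : Tendsto (fun s ↦ ‖x s‖⁻¹ • x s) l (𝓝 w)) :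
    Tendsto (fun s ↦ compactify (t s, x s)) l (𝓝 (scriPlusPoint u w)) := by
  have hv : Tendsto (fun s ↦ t s + ‖x s‖) l atTop := by
    have := hu.add_atTop (hx.const_mul_atTop two_pos)
    exact this.congr fun s ↦ by ring
  have hV := (tendsto_nhds_of_tendsto_nhdsWithin Real.tendsto_arctan_atTop).comp hv
  have hU := (Real.continuous_arctan.tendsto u).comp hu
  have hχ := hV.sub hU
  exact (hV.add hU).prodMk_nhds
    ((((Real.continuous_sin.tendsto _).comp hχ).smul hw).prodMk_nhds
      ((Real.continuous_cos.tendsto _).comp hχ))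

/-- Curves in the exterior region that recede to infinity with convergent advanced time and
direction have an endpoint on past null infinity. -/
theorem tendsto_compactify_scriMinusPoint {D : ℕ} {α : Type*} {l : Filter α} {t : α → ℝ}
    {x : α → Space D} {v : ℝ} {w : Space D} (hx : Tendsto (fun s ↦ ‖x s‖) l atTop)
    (hv : Tendsto (fun s ↦ t s + ‖x s‖) l (𝓝 v)) (hw : Tendsto (fun s ↦ ‖x s‖⁻¹ • x s) l (𝓝 w)) :
    Tendsto (fun s ↦ compactify (t s, x s)) l (𝓝 (scriMinusPoint v w)) := by
  have hu : Tendsto (fun s ↦ t s - ‖x s‖) l atBot := by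
    have := hv.add_atBot (tendsto_neg_atTop_atBot.comp (hx.const_mul_atTop two_pos))
    exact this.congr fun s ↦ by simp only [Function.comp_apply]; ring
  have hU := (tendsto_nhds_of_tendsto_nhdsWithin Real.tendsto_arctan_atBot).comp hu
  have hV := (Real.continuous_arctan.tendsto v).comp hv
  have hχ := hV.sub hU
  rw [sub_neg_eq_add] at hχ
  exact (hV.add hU).prodMk_nhds
    ((((Real.continuous_sin.tendsto _).comp hχ).smul hw).prodMk_nhds
      ((Real.continuous_cos.tendsto _).comp hχ))

/-! ### The time gain and straight lines with an impact parameter -/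

/-- An odd function, increasing near the origin and decreasing far from it, with limits `± π / 2`
at `± ∞`. It is the shape of the time gained along the curve of negative time of flight. -/
def timeGain (s : ℝ) : ℝ := Real.arctan s + 2 * s / (1 + s ^ 2)

theorem timeGain_neg (s : ℝ) : timeGain (-s) = -timeGain s := by
  simp only [timeGain, Real.arctan_neg]
  ring

/-- The decay rate `1/s²` is what matters: it is integrable, so the gain is finite, but its square
root is not, so the proper length is infinite in every dimension. The sign changes at `|s| = √3 <
2`. -/
theorem hasDerivAt_timeGain (s : ℝ) :
    HasDerivAt timeGain ((3 - s ^ 2) / (1 + s ^ 2) ^ 2) s := by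
  have h0 : 1 + s ^ 2 ≠ 0 := by positivity
  have h := (Real.hasDerivAt_arctan s).add (((hasDerivAt_id s).const_mul 2).div
    (((hasDerivAt_id s).pow 2).const_add 1) h0)
  refine h.congr_deriv ?_
  simp only [id, Pi.pow_apply]
  field_simp
  ring

theorem contDiff_timeGain : ContDiff ℝ ∞ timeGain := by
  refine Real.contDiff_arctan.add (ContDiff.div (by fun_prop) (by fun_prop) fun s ↦ ?_)
  positivity

theorem tendsto_timeGain_atTop : Tendsto timeGain atTop (𝓝 (Real.pi / 2)) := by
  have h : Tendsto (fun s : ℝ ↦ 2 * s / (1 + s ^ 2)) atTop (𝓝 0) := by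
    refine squeeze_zero' (g := fun s ↦ 2 / s) ?_ ?_ (tendsto_const_nhds.div_atTop tendsto_id)
    · filter_upwards [eventually_gt_atTop 0] with s hs
      positivity
    · filter_upwards [eventually_gt_atTop 0] with s hs
      rw [div_le_div_iff₀ (by positivity) hs]
      nlinarith
  unfold timeGain
  simpa using (tendsto_nhds_of_tendsto_nhdsWithin Real.tendsto_arctan_atTop).add h

section Line

variable {D : ℕ} {e n : Space D} (he : ‖e‖ = 1) (hn : ‖n‖ = 1) (hen : inner ℝ e n = 0) (b : ℝ)
include he hn hen

theorem norm_line (s : ℝ) : ‖b • e + s • n‖ = √(b ^ 2 + s ^ 2) := by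
  rw [eq_comm, Real.sqrt_eq_iff_mul_self_eq (by positivity) (norm_nonneg _), ← sq,
    norm_add_sq_real]
  simp [inner_smul_left, inner_smul_right, hen, norm_smul, he, hn]

theorem tendsto_norm_line_atTop : Tendsto (fun s : ℝ ↦ ‖b • e + s • n‖) atTop atTop := by
  refine tendsto_atTop_mono (fun s ↦ ?_) tendsto_id
  rw [norm_line he hn hen]
  exact Real.le_sqrt_of_sq_le (by simp only [id]; nlinarith)

theorem tendsto_sub_norm_line : Tendsto (fun s : ℝ ↦ s - ‖b • e + s • n‖) atTop (𝓝 0) := by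
  -- With `r² = b² + s²`, one has `s - r = -b² / (s + r)`.
  have h : Tendsto (fun s : ℝ ↦ -(b ^ 2 / (s + ‖b • e + s • n‖))) atTop (𝓝 (-0)) :=
    (tendsto_const_nhds.div_atTop
      (tendsto_id.atTop_add_atTop (tendsto_norm_line_atTop he hn hen b))).neg
  rw [neg_zero] at h
  refine h.congr' ?_
  filter_upwards [eventually_gt_atTop 0] with s hs
  have h1 : ‖b • e + s • n‖ ^ 2 = b ^ 2 + s ^ 2 := by
    rw [norm_line he hn hen, Real.sq_sqrt (by positivity)]
  have h2 : 0 < s + ‖b • e + s • n‖ := by positivity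
  rw [eq_comm, ← sub_eq_zero]
  field_simp
  linarith

theorem tendsto_direction_line :
    Tendsto (fun s : ℝ ↦ ‖b • e + s • n‖⁻¹ • (b • e + s • n)) atTop (𝓝 n) := by
  have hr := tendsto_norm_line_atTop he hn hen b
  have h1 : Tendsto (fun s : ℝ ↦ b / ‖b • e + s • n‖) atTop (𝓝 0) :=
    tendsto_const_nhds.div_atTop hr
  have h2 : Tendsto (fun s : ℝ ↦ 1 + (s - ‖b • e + s • n‖) / ‖b • e + s • n‖) atTop
      (𝓝 (1 + 0)) := tendsto_const_nhds.add ((tendsto_sub_norm_line he hn hen b).div_atTop hr)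
  have h3 := (h1.smul (tendsto_const_nhds (x := e))).add (h2.smul (tendsto_const_nhds (x := n)))
  simp only [zero_smul, add_zero, one_smul, zero_add] at h3
  refine h3.congr' ?_
  filter_upwards [hr.eventually_gt_atTop 0] with s hs
  rw [smul_add, smul_smul, smul_smul]
  congr 2
  · ring
  · field_simp
    ring

theorem tendsto_retarded_line (δ : ℝ) :
    Tendsto (fun s : ℝ ↦ s - δ * timeGain s - ‖b • e + s • n‖) atTop
      (𝓝 (-(δ * (Real.pi / 2)))) := by
  have := (tendsto_sub_norm_line he hn hen b).sub (tendsto_timeGain_atTop.const_mul δ)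
  rw [zero_sub] at this
  exact this.congr fun s ↦ by ring

end Line

/-! ### The curve and the asymptotic bounds on the metric -/

/-- A curve of impact parameter `b` in the coordinate region, whose time of flight is
`-δ π`. -/
def gainCurve {D : ℕ} (e n : Space D) (b δ s : ℝ) : ℝ × Space D :=
  (s - δ * timeGain s, b • e + s • n)

theorem contDiff_gainCurve {D : ℕ} (e n : Space D) (b δ : ℝ) :
    ContDiff ℝ ∞ (gainCurve e n b δ) := by
  have := contDiff_timeGain
  unfold gainCurve
  fun_prop

theorem hasDerivAt_gainCurve {D : ℕ} (e n : Space D) (b δ s : ℝ) :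
    HasDerivAt (gainCurve e n b δ)
      (((1 : ℝ), n) + (δ * ((s ^ 2 - 3) / (1 + s ^ 2) ^ 2)) • ((1 : ℝ), (0 : Space D))) s := by
  have h1 := (hasDerivAt_id s).sub ((hasDerivAt_timeGain s).const_mul δ)
  have h2 := ((hasDerivAt_id s).smul_const n).const_add (b • e)
  refine (h1.prodMk h2).congr_deriv ?_
  ext1
  · simp only [Prod.fst_add, Prod.smul_fst, smul_eq_mul]
    ring
  · simp

section Asymptotics

variable {D : ℕ} {M : Type*} [TopologicalSpace M] [ChartedSpace (ModelE D) M]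
  [IsManifold 𝓘(ℝ, ModelE D) ∞ M]

theorem coordMetric_add_smul (g : LorentzianMetric D M) (c : ExteriorCoordinates D M)
    (p a b : ℝ × Space D) (φ : ℝ) :
    coordMetric g c p (a + φ • b) (a + φ • b) =
      coordMetric g c p a a + 2 * φ * coordMetric g c p a b + φ ^ 2 * coordMetric g c p b b := by
  unfold coordMetric
  set L := mfderiv 𝓘(ℝ, ℝ × Space D) 𝓘(ℝ, ModelE D) c.toCoord.symm p
  have hL : L (a + φ • b) = L a + φ • L b := 
    (L.map_add a (φ • b)).trans (congrArg (L a + ·) (L.map_smul φ b))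
  have hs := g.symm (c.toCoord.symm p) (L b) (L a)
  rw [hL]
  simp only [map_add, map_smul, add_apply, smul_apply,
    smul_eq_mul, hs]
  ring

theorem schwarzschildMetric_time_right (m : ℝ) (p a : ℝ × Space D) :
    schwarzschildMetric D m p a (1, 0) = -(1 - 2 * m / ‖p.2‖ ^ (D - 2)) * a.1 := by
  simp [schwarzschildMetric]

/-- For negative mass, Minkowski-null vectors are timelike for the Schwarzschild metric. -/
theorem schwarzschildMetric_null_le {m : ℝ} (hm : m < 0) {p : ℝ × Space D} (hp : 0 < ‖p.2‖)
    {n : Space D} (hn : ‖n‖ = 1) :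
    schwarzschildMetric D m p (1, n) (1, n) ≤ 2 * m / ‖p.2‖ ^ (D - 2) := by
  have hA : 2 * m / ‖p.2‖ ^ (D - 2) < 0 := div_neg_of_neg_of_pos (by linarith) (by positivity)
  set A := 2 * m / ‖p.2‖ ^ (D - 2) with hAdef
  simp only [schwarzschildMetric, ← hAdef, real_inner_self_eq_norm_sq, hn]
  set q := inner ℝ p.2 n / ‖p.2‖
  -- With `A < 0`, the value on `k` is `A - (1 - (1 - A)⁻¹) q²`, and the second term only helps.
  have h1 : (1 - A)⁻¹ ≤ 1 := inv_le_one_of_one_le₀ (by linarith)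
  have h2 : (1 - A)⁻¹ * (q * q) ≤ 1 * (q * q) := by gcongr; exact mul_self_nonneg q
  linarith

/-- Write `ε = |m| / r^(D-2)`. The Schwarzschild values are at most `-2ε` on `(k,k)` and equal to
`-(1 + 2ε)` on `(k,∂_t)` and `(∂_t,∂_t)`. Far out the error is at most `ε`, so half of the negative
term on `(k,k)` survives and `m₀ = |m|` works; `ε < 1/4` confines the mixed term. -/
theorem IsAsymptoticallySchwarzschildean.exists_bounds {g : LorentzianMetric D M}
    {c : ExteriorCoordinates D M} {mADM : ℝ} (hD : 3 ≤ D)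
    (hg : IsAsymptoticallySchwarzschildean g c mADM) (hm : mADM < 0) {n : Space D}
    (hn : ‖n‖ = 1) :
    ∃ m₀ > 0, ∃ ρ > c.R, ∀ p : ℝ × Space D, ρ ≤ ‖p.2‖ →
      coordMetric g c p (1, n) (1, n) ≤ -(m₀ / ‖p.2‖ ^ (D - 2)) ∧
      coordMetric g c p (1, n) (1, 0) ∈ Icc (-2) (-(1 / 2) : ℝ) ∧
      coordMetric g c p (1, 0) (1, 0) ≤ 0 := by
  obtain ⟨-, m, hmADM, -, has⟩ := hg
  have hm0 : m < 0 := by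
    by_contra h
    push Not at h
    have : 0 ≤ admMass D m := by
      have h3 : (3 : ℝ) ≤ D := by exact_mod_cast hD
      have h4 : 0 ≤ sphereArea D := measureReal_nonneg
      have h5 := Real.pi_pos
      unfold admMass
      refine mul_nonneg (div_nonneg (mul_nonneg (by linarith) h4) (by positivity)) h
    linarith
  have hsmall : Tendsto (fun p : ℝ × Space D ↦ |m| / ‖p.2‖ ^ (D - 2))
      (comap (fun p : ℝ × Space D ↦ ‖p.2‖) atTop) (𝓝 0) :=
    tendsto_const_nhds.div_atTop
      ((tendsto_pow_atTop (show D - 2 ≠ 0 by omega)).comp tendsto_comap)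
  have hev := ((((has (1, n) (1, n)).def one_pos).and
    ((has (1, n) (1, 0)).def one_pos)).and ((has (1, 0) (1, 0)).def one_pos)).and
    (hsmall.eventually (gt_mem_nhds (show (0 : ℝ) < 1 / 4 by norm_num)))
  rw [eventually_comap] at hev
  obtain ⟨ρ, hρ⟩ := eventually_atTop.1 hev
  refine ⟨|m|, abs_pos.2 hm0.ne, max ρ (c.R + 1),
    (lt_add_one c.R).trans_le (le_max_right _ _), fun p hp ↦ ?_⟩
  obtain ⟨⟨⟨h1, h2⟩, h3⟩, h4⟩ := hρ _ ((le_max_left _ _).trans hp) p rfl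
  have hr : 0 < ‖p.2‖ := by
    have := (le_max_right ρ (c.R + 1)).trans hp
    linarith [c.R_pos]
  have hk := schwarzschildMetric_null_le hm0 hr hn (D := D)
  have hA : 2 * m / ‖p.2‖ ^ (D - 2) = -2 * (|m| / ‖p.2‖ ^ (D - 2)) := by
    rw [abs_of_neg hm0]; ring
  have hA0 : 0 ≤ |m| / ‖p.2‖ ^ (D - 2) := by positivity
  rw [schwarzschildMetric_time_right] at h2 h3
  simp only [Real.norm_eq_abs, one_mul, abs_of_nonneg hA0, hA, mul_one] at h1 h2 h3 hk
  rw [abs_le] at h1 h2 h3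
  refine ⟨by linarith, ⟨by linarith, by linarith⟩, by linarith⟩

end Asymptotics

theorem exists_norm_eq_one_inner_eq_zero {D : ℕ} (hD : 2 ≤ D) (n : Space D) :
    ∃ e : Space D, ‖e‖ = 1 ∧ inner ℝ e n = 0 := by
  have hne : (ℝ ∙ n)ᗮ ≠ ⊥ := by
    intro h
    have h1 := (ℝ ∙ n).finrank_add_finrank_orthogonal
    have h2 := finrank_span_le_card (R := ℝ) ({n} : Set (Space D))
    rw [h, finrank_bot, finrank_euclideanSpace_fin] at h1
    rw [toFinset_singleton, Finset.card_singleton] at h2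
    omega
  obtain ⟨x, hx, hx0⟩ := (Submodule.ne_bot_iff _).1 hne
  refine ⟨‖x‖⁻¹ • x, by simp [norm_smul, hx0], ?_⟩
  rw [inner_smul_left, real_inner_comm, Submodule.mem_orthogonal_singleton_iff_inner_right.1 hx,
    mul_zero]

/-! ### Transfer to the spacetime: endlessness, velocities and endpoints -/

/-- A curve whose proper length per unit parameter is at least `κ / |s|` in the far past and in
the far future is endless. -/
theorem LorentzianMetric.isEndless_of_inner_le {D : ℕ} {M : Type*} [TopologicalSpace M]
    [ChartedSpace (ModelE D) M] [IsManifold 𝓘(ℝ, ModelE D) ∞ M] (g : LorentzianMetric D M)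
    {γ : ℝ → M} (hγ : MDifferentiable 𝓘(ℝ, ℝ) 𝓘(ℝ, ModelE D) γ) {κ s₀ : ℝ} (hκ : 0 < κ)
    (h : ∀ s, s₀ ≤ |s| → g.inner (γ s) (mfderiv 𝓘(ℝ, ℝ) 𝓘(ℝ, ModelE D) γ s (1 : ℝ))
      (mfderiv 𝓘(ℝ, ℝ) 𝓘(ℝ, ModelE D) γ s (1 : ℝ)) ≤ -(κ / s) ^ 2) :
    IsEndless γ := by
  intro p
  constructor
  · refine g.not_tendsto_nhds_of_inner_le hγ hκ ?_ p
    filter_upwards [eventually_ge_atTop s₀] with s hs using h s (hs.trans (le_abs_self s))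
  · intro hp
    -- The past is reduced to the future by reversing the parameter; the sign of the velocity drops
    -- out of the quadratic form.
    have hneg : ∀ s : ℝ, HasMFDerivAt 𝓘(ℝ, ℝ) 𝓘(ℝ, ModelE D) (γ ∘ Neg.neg) s
        ((mfderiv 𝓘(ℝ, ℝ) 𝓘(ℝ, ModelE D) γ (-s)).comp
          (-ContinuousLinearMap.id ℝ ℝ : ℝ →L[ℝ] ℝ)) := fun s ↦
      (hγ (-s)).hasMFDerivAt.comp s (hasFDerivAt_id s).neg.hasMFDerivAt
    refine g.not_tendsto_nhds_of_inner_le (γ := γ ∘ Neg.neg)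
      (fun s ↦ (hneg s).mdifferentiableAt) hκ ?_ p (hp.comp tendsto_neg_atTop_atBot)
    filter_upwards [eventually_ge_atTop s₀] with s hs
    have h1 := h (-s) (by rw [abs_neg]; exact hs.trans (le_abs_self s))
    have h2 : mfderiv 𝓘(ℝ, ℝ) 𝓘(ℝ, ModelE D) (γ ∘ Neg.neg) s (1 : ℝ) =
        -(mfderiv 𝓘(ℝ, ℝ) 𝓘(ℝ, ModelE D) γ (-s) (1 : ℝ)) := by
      rw [(hneg s).mfderiv]
      exact (mfderiv 𝓘(ℝ, ℝ) 𝓘(ℝ, ModelE D) γ (-s)).map_neg (1 : ℝ)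
    rw [div_neg, neg_sq] at h1
    rw [h2]
    simpa using h1

namespace ExteriorCoordinates

variable {D : ℕ} {M : Type*} [TopologicalSpace M] [ChartedSpace (ModelE D) M]
  (c : ExteriorCoordinates D M) {γ : ℝ → ℝ × Space D}

theorem contMDiff_symm_comp (hγ : ContDiff ℝ ∞ γ) (hR : ∀ s, c.R < ‖(γ s).2‖) :
    ContMDiff 𝓘(ℝ, ℝ) 𝓘(ℝ, ModelE D) ∞ (c.toCoord.symm ∘ γ) := by
  rw [← contMDiffOn_univ]
  refine c.contMDiffOn_symm.comp hγ.contMDiff.contMDiffOn fun s _ ↦ ?_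
  rw [mem_preimage, c.target_eq]
  exact hR s

theorem inner_mfderiv_symm_comp [IsManifold 𝓘(ℝ, ModelE D) ∞ M] (g : LorentzianMetric D M)
    {γ' : ℝ × Space D} {s : ℝ} (hγ : HasDerivAt γ γ' s) (hR : c.R < ‖(γ s).2‖) :
    g.inner ((c.toCoord.symm ∘ γ) s)
      (mfderiv 𝓘(ℝ, ℝ) 𝓘(ℝ, ModelE D) (c.toCoord.symm ∘ γ) s (1 : ℝ))
      (mfderiv 𝓘(ℝ, ℝ) 𝓘(ℝ, ModelE D) (c.toCoord.symm ∘ γ) s (1 : ℝ)) =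
    coordMetric g c (γ s) γ' γ' := by
  have hmem : γ s ∈ c.toCoord.target := by rw [c.target_eq]; exact hR
  have hd : MDifferentiableAt 𝓘(ℝ, ℝ × Space D) 𝓘(ℝ, ModelE D) c.toCoord.symm (γ s) :=
    (c.contMDiffOn_symm.contMDiffAt (c.toCoord.open_target.mem_nhds hmem)).mdifferentiableAt
      (by simp)
  have h1 := (hd.hasMFDerivAt.comp s hγ.hasFDerivAt.hasMFDerivAt).mfderiv
  have h2 : mfderiv 𝓘(ℝ, ℝ) 𝓘(ℝ, ModelE D) (c.toCoord.symm ∘ γ) s (1 : ℝ) =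
      mfderiv 𝓘(ℝ, ℝ × Space D) 𝓘(ℝ, ModelE D) c.toCoord.symm (γ s) γ' := by
    rw [h1]
    exact congrArg (mfderiv 𝓘(ℝ, ℝ × Space D) 𝓘(ℝ, ModelE D) c.toCoord.symm (γ s)) (one_smul ℝ γ')
  rw [h2]
  rfl

theorem toCoord_symm_comp (hR : ∀ s, c.R < ‖(γ s).2‖) (s : ℝ) :
    (c.toCoord.symm ∘ γ) s ∈ c.toCoord.source ∧ c.toCoord ((c.toCoord.symm ∘ γ) s) = γ s := by
  have hmem : γ s ∈ c.toCoord.target := by rw [c.target_eq]; exact hR s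
  exact ⟨c.toCoord.map_target hmem, c.toCoord.right_inv hmem⟩

end ExteriorCoordinates

section Endpoints

variable {D : ℕ} {M : Type*} [TopologicalSpace M] [ChartedSpace (ModelE D) M]
  (c : ExteriorCoordinates D M) {e n : Space D} (he : ‖e‖ = 1) (hn : ‖n‖ = 1)
  (hen : inner ℝ e n = 0) (b δ : ℝ) (hR : ∀ s, c.R < ‖(gainCurve e n b δ s).2‖)
include he hn hen hR

theorem hasFutureEndpointAt_gainCurve :
    HasFutureEndpointAt c n (c.toCoord.symm ∘ gainCurve e n b δ) (-(δ * (Real.pi / 2))) := by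
  refine ⟨.of_forall fun s ↦ (c.toCoord_symm_comp hR s).1, ?_⟩
  simp only [(c.toCoord_symm_comp hR _).2]
  exact tendsto_compactify_scriPlusPoint (tendsto_norm_line_atTop he hn hen b)
    (tendsto_retarded_line he hn hen b δ) (tendsto_direction_line he hn hen b)

/-- Since `timeGain` is odd, time reversal together with `n ↦ -n` preserves the family of curves and
exchanges retarded time with minus advanced time. -/
theorem hasPastEndpointAt_gainCurve :
    HasPastEndpointAt c n (c.toCoord.symm ∘ gainCurve e n b δ) (δ * (Real.pi / 2)) := by
  refine ⟨.of_forall fun s ↦ (c.toCoord_symm_comp hR s).1, ?_⟩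
  simp only [(c.toCoord_symm_comp hR _).2]
  have hn' : ‖-n‖ = 1 := by rwa [norm_neg]
  have hen' : inner ℝ e (-n) = 0 := by rw [inner_neg_right, hen, neg_zero]
  have hv := (tendsto_retarded_line he hn' hen' b δ).neg
  rw [neg_neg] at hv
  have h := tendsto_compactify_scriMinusPoint (t := fun s ↦ -s - δ * timeGain (-s))
    (tendsto_norm_line_atTop he hn' hen' b)
    (hv.congr fun s ↦ by rw [timeGain_neg]; ring) (tendsto_direction_line he hn' hen' b)
  refine (h.comp tendsto_neg_atBot_atTop).congr fun s ↦ ?_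
  simp [gainCurve]

end Endpoints

/-! ### Choice of the constants and conclusion -/

/-- At an impact parameter at which Minkowski-null lines are timelike, a small enough time gain
keeps the curve timelike, with proper length at least `κ / |s|` per unit parameter far out. -/
theorem exists_gainCurve_coordMetric_lt {D : ℕ} {M : Type*} [TopologicalSpace M]
    [ChartedSpace (ModelE D) M] [IsManifold 𝓘(ℝ, ModelE D) ∞ M] (g : LorentzianMetric D M)
    (c : ExteriorCoordinates D M) {n e : Space D} (hn : ‖n‖ = 1) (he : ‖e‖ = 1)
    (hen : inner ℝ e n = 0) {m₀ b : ℝ} (hm₀ : 0 < m₀) (hb : 0 < b)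
    (hbound : ∀ p : ℝ × Space D, b ≤ ‖p.2‖ →
      coordMetric g c p (1, n) (1, n) ≤ -(m₀ / ‖p.2‖ ^ (D - 2)) ∧
      coordMetric g c p (1, n) (1, 0) ∈ Icc (-2) (-(1 / 2) : ℝ) ∧
      coordMetric g c p (1, 0) (1, 0) ≤ 0) :
    ∃ δ > 0, ∃ κ > 0, ∀ s,
      coordMetric g c (gainCurve e n b δ s) (deriv (gainCurve e n b δ) s)
        (deriv (gainCurve e n b δ) s) < 0 ∧
      (2 ≤ |s| → coordMetric g c (gainCurve e n b δ s) (deriv (gainCurve e n b δ) s)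
        (deriv (gainCurve e n b δ) s) ≤ -(κ / s) ^ 2) := by
  set μ := m₀ / √(b ^ 2 + 2 ^ 2) ^ (D - 2) with hμ
  have hμ0 : 0 < μ := by positivity
  -- `μ` bounds `-g(k,k)` from below for `|s| ≤ 2`. There `|φ| ≤ 3δ` and `|g(k,∂_t)| ≤ 2`, so the
  -- cross term is at most `12δ = μ/2`. Far out the squared length rate is at least `δ / (10 s²)`,
  -- hence `κ² = δ/10 = μ/240`.
  refine ⟨μ / 24, by positivity, √(μ / 240), by positivity, fun s ↦ ?_⟩
  set δ := μ / 24 with hδ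
  have hδ0 : 0 < δ := by positivity
  rw [(hasDerivAt_gainCurve e n b δ s).deriv, coordMetric_add_smul]
  have hnorm : ‖(gainCurve e n b δ s).2‖ = √(b ^ 2 + s ^ 2) := norm_line he hn hen b s
  have hbs : b ≤ √(b ^ 2 + s ^ 2) := Real.le_sqrt_of_sq_le (by nlinarith)
  obtain ⟨hkk, ⟨hk0, hk0'⟩, h00⟩ := hbound (gainCurve e n b δ s) (by rw [hnorm]; exact hbs)
  rw [hnorm] at hkk
  set Gkk := coordMetric g c (gainCurve e n b δ s) (1, n) (1, n)
  set Gk0 := coordMetric g c (gainCurve e n b δ s) (1, n) (1, 0)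
  set G00 := coordMetric g c (gainCurve e n b δ s) (1, 0) (1, 0)
  set φ := δ * ((s ^ 2 - 3) / (1 + s ^ 2) ^ 2) with hφ
  have h1 : φ ^ 2 * G00 ≤ 0 := mul_nonpos_of_nonneg_of_nonpos (sq_nonneg _) h00
  have hfar : 2 ≤ |s| →
      Gkk + 2 * φ * Gk0 + φ ^ 2 * G00 ≤ -(√(μ / 240) / s) ^ 2 := by
    intro hs
    have hs2 : 4 ≤ s ^ 2 := by rw [← sq_abs]; nlinarith
    have hkk' : Gkk ≤ 0 := hkk.trans (neg_nonpos.2 (by positivity))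
    -- The factor 10 suffices because `(1 + x)² ≤ 10 x (x - 3)` for `x = s² ≥ 4`.
    have hφ1 : δ / 10 / s ^ 2 ≤ φ := by
      rw [hφ, div_div, ← mul_div_assoc, div_le_div_iff₀ (by positivity) (by positivity)]
      have : (1 + s ^ 2) ^ 2 ≤ (s ^ 2 - 3) * (10 * s ^ 2) := by nlinarith
      nlinarith
    have hφ0 : 0 ≤ φ := le_trans (by positivity) hφ1
    have : (√(μ / 240) / s) ^ 2 = δ / 10 / s ^ 2 := by
      rw [div_pow, Real.sq_sqrt (by positivity), hδ]; ring
    rw [this]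
    -- Since `φ ≥ 0` and `Gk0 ≤ -1/2`, the cross term is at most `-φ`; the other two terms are
    -- nonpositive.
    nlinarith
  refine ⟨?_, hfar⟩
  rcases le_or_gt 2 |s| with hs | hs
  · have hs0 : s ≠ 0 := by rintro rfl; norm_num at hs
    exact (hfar hs).trans_lt (neg_neg_of_pos (by positivity))
  · have hs2 : s ^ 2 ≤ 2 ^ 2 := sq_le_sq' (abs_lt.1 hs).1.le (abs_lt.1 hs).2.le
    have hkk' : Gkk ≤ -μ := by
      refine hkk.trans (neg_le_neg ?_)
      rw [hμ]
      gcongr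
    have hψ : |(s ^ 2 - 3) / (1 + s ^ 2) ^ 2| ≤ 3 := by
      rw [abs_le, le_div_iff₀ (by positivity), div_le_iff₀ (by positivity)]
      constructor <;> nlinarith [sq_nonneg s]
    have hφ3 : |φ| ≤ δ * 3 := by
      rw [hφ, abs_mul, abs_of_pos hδ0]
      gcongr
    have hG : |Gk0| ≤ 2 := abs_le.2 ⟨hk0, by linarith⟩
    have h2 : φ * Gk0 ≤ δ * 3 * 2 := by
      refine (le_abs_self _).trans ?_
      rw [abs_mul]
      gcongr
    linarith
end

theorem lemma4p1 (D : ℕ) (hD : 3 ≤ D)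
    (M : Type*) [TopologicalSpace M] [T2Space M] [SecondCountableTopology M] [ConnectedSpace M]
    [ChartedSpace (ModelE D) M] [IsManifold 𝓘(ℝ, ModelE D) ∞ M]
    (g : LorentzianMetric D M) (c : ExteriorCoordinates D M) (mADM : ℝ)
    (hg : IsAsymptoticallySchwarzschildean g c mADM) (hm : mADM < 0)
    (n : Space D) (hn : ‖n‖ = 1) :
    ∃ (γ : ℝ → M) (uInf vInf : ℝ),
      IsTimelikeCurve g γ ∧ IsEndless γ ∧
      HasPastEndpointAt c n γ vInf ∧ HasFutureEndpointAt c n γ uInf ∧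
      uInf - vInf < 0 := by
  obtain ⟨e, he, hen⟩ := exists_norm_eq_one_inner_eq_zero (by omega) n
  obtain ⟨m₀, hm₀, b, hb, hbound⟩ := hg.exists_bounds hD hm hn
  have hb0 : 0 < b := c.R_pos.trans hb
  obtain ⟨δ, hδ, κ, hκ, hneg⟩ := exists_gainCurve_coordMetric_lt g c hn he hen hm₀ hb0 hbound
  have hR : ∀ s, c.R < ‖(gainCurve e n b δ s).2‖ := fun s ↦ hb.trans_le <| by
    rw [gainCurve, norm_line he hn hen]
    exact Real.le_sqrt_of_sq_le (by nlinarith)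
  have hsmooth := c.contMDiff_symm_comp (contDiff_gainCurve e n b δ) hR
  have hinner := fun s ↦ c.inner_mfderiv_symm_comp g
    (hasDerivAt_gainCurve e n b δ s).differentiableAt.hasDerivAt (hR s)
  refine ⟨c.toCoord.symm ∘ gainCurve e n b δ, -(δ * (Real.pi / 2)), δ * (Real.pi / 2),
    ⟨hsmooth, fun s ↦ (hinner s).trans_lt (hneg s).1⟩,
    g.isEndless_of_inner_le (hsmooth.mdifferentiable (by simp)) hκ
      fun s hs ↦ (hinner s).trans_le ((hneg s).2 hs),
    hasPastEndpointAt_gainCurve c he hn hen b δ hR,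
    hasFutureEndpointAt_gainCurve c he hn hen b δ hR, ?_⟩
  have := mul_pos hδ Real.pi_pos
  linarith
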